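/- Let $R$ be a commutative ring. An $\mathcal R$-module is a covariant functor $\mathbb M$ from commutative $R$-algebras to abelian groups with an $R'$-module structure on $\mathbb M(R')$ for every commutative $R$-algebra $R'$, compatible with all morphisms of $R$-algebras; morphisms of $\mathcal R$-modules are the natural transformations that are $R'$-linear for every $R'$. An $R$-module $M$ defines the quasi-coherent $\mathcal R$-module $\mathcal M$, $\mathcal M(R') = M\otimes_R R'$, and its dual $\mathcal M^*$, $\mathcal M^*(R') = \operatorname{Hom}_{R'}(M\otimes_R R', R')$, called the module scheme associated with $M$. An $R$-module scheme is a commutative group $R$-scheme $X$ with a morphism of $R$-schemes $\mathbb A^1_R\times_R X\to X$ satisfying the module axioms; its functor of points $X^{\cdot}(R')=\operatorname{Hom}_{R\text{-sch}}(\operatorname{Spec}R',X)$ is an $\mathcal R$-module, and an $\mathcal R$-module is called an $\mathcal R$-module scheme if it is isomorphic to $X^{\cdot}$ for some $R$-module scheme $X$. Direct limits are taken in the category of $\mathcal R$-modules, over upward directed sets. Theorem. Let $M$ be an $R$-module. The following statements are equivalent: (1) $M$ is a flat $R$-module. (2) $\mathcal M$ is a direct limit of module schemes associated with $R$-modules,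 $\mathcal M=\varinjlim_i \mathcal N_i^*$ for some $R$-modules $N_i$. (3) $\mathcal M$ is a direct limit of $\mathcal R$-module schemes. -/

import Mathlib

open CategoryTheory Limits AlgebraicGeometry Opposite TensorProduct MonoidalCategory
open CartesianMonoidalCategory
open scoped AddMonObj

universe u

noncomputable section

namespace FunctorialModules

/-! ### Functors of `𝓡`-modules on commutative `R`-algebras -/

/-- The functor of rings `𝓡` on commutative `R`-algebras, `𝓡(R') = R'`. A covariant functor on
commutative `R`-algebras is regarded as a presheaf on the opposite category. -/
def ringFunctor (R : Type u) [CommRing R] : (CommAlgCat.{u} R)ᵒᵖᵒᵖ ⥤ RingCat.{u} :=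
  unopUnop _ ⋙ forget₂ (CommAlgCat.{u} R) CommRingCat.{u} ⋙ forget₂ CommRingCat.{u} RingCat.{u}

/-- The category of `𝓡`-modules: functors `𝕄` of abelian groups on commutative `R`-algebras
with a functorial `R'`-module structure on each `𝕄(R')`. -/
abbrev ModuleFunctor (R : Type u) [CommRing R] := PresheafOfModules.{u} (ringFunctor R)

section

variable (R : Type u) [CommRing R]

/-- Constructor for `𝓡`-modules from unbundled data: a module `F A` over each commutative
`R`-algebra `A`, and functorial semilinear maps `F A → F B` along algebra maps `A → B`. -/
def ModuleFunctor.mk' (F : CommAlgCat.{u} R → Type u) [∀ A, AddCommGroup (F A)]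
    [∀ A : CommAlgCat.{u} R, Module A (F A)]
    (map : ∀ {A B : CommAlgCat.{u} R}, (A ⟶ B) → F A →+ F B)
    (map_smul : ∀ {A B : CommAlgCat.{u} R} (f : A ⟶ B) (a : A) (x : F A),
      map f (a • x) = f.hom a • map f x)
    (map_id : ∀ (A : CommAlgCat.{u} R) (x : F A), map (𝟙 A) x = x)
    (map_comp : ∀ {A B C : CommAlgCat.{u} R} (f : A ⟶ B) (g : B ⟶ C) (x : F A),
      map (f ≫ g) x = map g (map f x)) : ModuleFunctor R :=
  letI : ∀ A : (CommAlgCat.{u} R)ᵒᵖᵒᵖ, Module ((ringFunctor R).obj A) (F A.unop.unop) :=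
    fun A => inferInstanceAs (Module A.unop.unop (F A.unop.unop))
  PresheafOfModules.ofPresheaf (R := ringFunctor R)
    { obj := fun A => AddCommGrpCat.of (F A.unop.unop)
      map := fun f => AddCommGrpCat.ofHom (map f.unop.unop)
      map_id := fun A => by ext x; exact map_id _ x
      map_comp := fun f g => by ext x; exact map_comp _ _ x }
    (fun _ _ f a x => map_smul f.unop.unop a x)

variable (M : Type u) [AddCommGroup M] [Module R M]

/-- The quasi-coherent `𝓡`-module `𝓜` associated with an `R`-module `M`:
`𝓜(R') = R' ⊗[R] M`. -/
def quasiCoherent : ModuleFunctor R :=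
  ModuleFunctor.mk' R (fun A => A ⊗[R] M)
    (fun f => (f.hom.toLinearMap.rTensor M).toAddMonoidHom)
    (fun f a x => by
      induction x with
      | zero => simp
      | tmul b m => simp [TensorProduct.smul_tmul']
      | add x y hx hy => simp_all [smul_add])
    (fun A x => by
      induction x with
      | zero => simp
      | tmul b m => simp
      | add x y hx hy => simp_all)
    (fun f g x => by
      induction x with
      | zero => simp
      | tmul b m => simp
      | add x y hx hy => simp_all)

variable {R M}

/-- The transition map `Hom_A(A ⊗ M, A) → Hom_B(B ⊗ M, B)` of the dual functor `𝓜^*` along an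
algebra map `f : A → B`: the image of `w` is the `B`-linear form with `1 ⊗ m ↦ f (w (1 ⊗ m))`. -/
def dualMap {A B : CommAlgCat.{u} R} (f : A ⟶ B) :
    Module.Dual A (A ⊗[R] M) →+ Module.Dual B (B ⊗[R] M) where
  toFun w := LinearMap.liftBaseChange B
    (f.hom.toLinearMap ∘ₗ w.restrictScalars R ∘ₗ TensorProduct.mk R A M 1)
  map_zero' := by ext; simp
  map_add' w w' := by ext; simp

/-- `dualMap f w` is the form on `B ⊗ M` compatible with `w` under base change. -/
theorem dualMap_rTensor {A B : CommAlgCat.{u} R} (f : A ⟶ B) (w : Module.Dual A (A ⊗[R] M))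
    (t : A ⊗[R] M) : dualMap f w (f.hom.toLinearMap.rTensor M t) = f.hom (w t) := by
  induction t with
  | zero => simp
  | tmul a m =>
    have h : w (a ⊗ₜ[R] m) = a * w (1 ⊗ₜ[R] m) := by
      rw [← smul_eq_mul, ← map_smul, TensorProduct.smul_tmul', smul_eq_mul, mul_one]
    simp [dualMap, h]
  | add x y hx hy => simp_all

variable (R M)

/-- The dual functor `𝓜^*`, i.e. the `𝓡`-module scheme associated with an `R`-module `M`:
`𝓜^*(R') = Hom_{R'}(R' ⊗[R] M, R')`. -/
def dualFunctor : ModuleFunctor R :=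
  ModuleFunctor.mk' R (fun A => Module.Dual A (A ⊗[R] M)) dualMap
    (fun f a w => by ext; simp [dualMap])
    (fun A w => by ext; simp [dualMap])
    (fun f g w => by ext; simp [dualMap])

end

/-! ### Module schemes -/

section

variable (R : Type u) [CommRing R]

/-- The affine line `𝔸¹` over `Spec R`. -/
def affineLine : Over (Spec (CommRingCat.of R)) :=
  Over.mk (𝔸(PUnit.{u + 1}; Spec (CommRingCat.of R)) ↘ Spec (CommRingCat.of R))

variable {R}

/-- The `R`-morphism `T ⟶ 𝔸¹` given by a global function on the `R`-scheme `T`. Every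
`R`-morphism `T ⟶ 𝔸¹` arises in this way from exactly one function. -/
def toAffineLine {T : Over (Spec (CommRingCat.of R))} (a : Γ(T.left, ⊤)) : T ⟶ affineLine R :=
  Over.homMk (AffineSpace.homOfVector T.hom fun _ => a) (AffineSpace.homOfVector_over _ _)

theorem toAffineLine_bijective (T : Over (Spec (CommRingCat.of R))) :
    Function.Bijective (toAffineLine (T := T)) := by
  constructor
  · intro a b h
    have h' := congrArg (fun f : T ⟶ affineLine R =>
      f.left.appTop (AffineSpace.coord (Spec (CommRingCat.of R)) PUnit.unit)) h
    exact (AffineSpace.homOfVector_appTop_coord T.hom (fun _ => a) PUnit.unit).symm.trans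
      (h'.trans (AffineSpace.homOfVector_appTop_coord T.hom (fun _ => b) PUnit.unit))
  · intro f
    refine ⟨f.left.appTop (AffineSpace.coord (Spec (CommRingCat.of R)) PUnit.unit), ?_⟩
    apply Over.OverMorphism.ext
    apply AffineSpace.hom_ext
    · exact (AffineSpace.homOfVector_over _ _).trans (Over.w f).symm
    · rintro ⟨⟩
      exact AffineSpace.homOfVector_appTop_coord _ _ _

theorem comp_toAffineLine {S T : Over (Spec (CommRingCat.of R))} (g : S ⟶ T)
    (a : Γ(T.left, ⊤)) : g ≫ toAffineLine a = toAffineLine (g.left.appTop a) := by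
  apply Over.OverMorphism.ext
  refine (AffineSpace.comp_homOfVector _ _ _).trans ?_
  rw [Over.w g]
  rfl

variable (R)

/-- An `R`-module scheme: a commutative group `R`-scheme `X` with an `R`-morphism
`𝔸¹ × X ⟶ X` satisfying the module axioms, which are expressed on `T`-valued points
for all `R`-schemes `T`. -/
structure ModuleScheme where
  /-- the underlying `R`-scheme -/
  X : Over (Spec (CommRingCat.of R))
  [addGrpObj : AddGrpObj X]
  [isComm : IsCommAddMonObj X]
  /-- the scalar multiplication -/
  act : affineLine R ⊗ X ⟶ X
  act_add : ∀ {T : Over (Spec (CommRingCat.of R))} (a : Γ(T.left, ⊤)) (x y : T ⟶ X),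
    lift (toAffineLine a) (x + y) ≫ act =
      lift (toAffineLine a) x ≫ act + lift (toAffineLine a) y ≫ act
  add_act : ∀ {T : Over (Spec (CommRingCat.of R))} (a b : Γ(T.left, ⊤)) (x : T ⟶ X),
    lift (toAffineLine (a + b)) x ≫ act =
      lift (toAffineLine a) x ≫ act + lift (toAffineLine b) x ≫ act
  mul_act : ∀ {T : Over (Spec (CommRingCat.of R))} (a b : Γ(T.left, ⊤)) (x : T ⟶ X),
    lift (toAffineLine (a * b)) x ≫ act =
      lift (toAffineLine a) (lift (toAffineLine b) x ≫ act) ≫ act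
  one_act : ∀ {T : Over (Spec (CommRingCat.of R))} (x : T ⟶ X),
    lift (toAffineLine 1) x ≫ act = x

namespace ModuleScheme

attribute [instance] addGrpObj isComm

variable {R} (X : ModuleScheme R)

/-- The `O(T)`-module structure on the group of `T`-valued points of a module scheme. -/
@[reducible]
def pointsModule (T : Over (Spec (CommRingCat.of R))) : Module Γ(T.left, ⊤) (T ⟶ X.X) where
  smul a x := lift (toAffineLine a) x ≫ X.act
  one_smul := X.one_act
  mul_smul := X.mul_act
  smul_zero a := by
    have h := X.act_add a (0 : T ⟶ X.X) 0
    rw [add_zero] at h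
    exact left_eq_add.mp h
  smul_add := X.act_add
  add_smul := X.add_act
  zero_smul x := by
    have h := X.add_act (0 : Γ(T.left, ⊤)) 0 x
    rw [add_zero] at h
    exact left_eq_add.mp h

/-- The points of a module scheme with values in a commutative `R`-algebra `A`, that is, the
`R`-morphisms `Spec A ⟶ X`. -/
abbrev Points (A : CommAlgCat.{u} R) : Type u :=
  (algSpec (CommRingCat.of R)).obj (op A) ⟶ X.X

/-- An element of a commutative `R`-algebra `A` as a global function on `Spec A`. -/
def toFunction (A : CommAlgCat.{u} R) :
    A →+* Γ(((algSpec (CommRingCat.of R)).obj (op A)).left, ⊤) :=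
  (Scheme.ΓSpecIso (CommRingCat.of A)).inv.hom

theorem toFunction_naturality {A B : CommAlgCat.{u} R} (f : A ⟶ B) (a : A) :
    ((algSpec (CommRingCat.of R)).map f.op).left.appTop (toFunction A a) =
      toFunction B (f.hom a) :=
  (ConcreteCategory.congr_hom
    (Scheme.ΓSpecIso_inv_naturality (CommRingCat.ofHom f.hom.toRingHom)) a).symm

instance (A : CommAlgCat.{u} R) : Module A (X.Points A) :=
  letI := X.pointsModule ((algSpec (CommRingCat.of R)).obj (op A))
  Module.compHom (X.Points A) (toFunction A)

theorem smul_points_def {A : CommAlgCat.{u} R} (a : A) (x : X.Points A) :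
    a • x = lift (toAffineLine (toFunction A a)) x ≫ X.act := rfl

/-- The functor of points `X^·` of a module scheme, as an `𝓡`-module:
`X^·(R') = Hom_R(Spec R', X)`. -/
def functorOfPoints : ModuleFunctor R :=
  ModuleFunctor.mk' R X.Points
    (fun f => AddMonoidHom.mk' (fun x => (algSpec (CommRingCat.of R)).map f.op ≫ x)
      (fun x y => AddMonObj.comp_add _ x y))
    (fun {A B} f a x => by
      simp only [AddMonoidHom.mk'_apply, smul_points_def]
      rw [← Category.assoc, comp_lift, comp_toAffineLine, toFunction_naturality])
    (fun A x => by
      simp only [AddMonoidHom.mk'_apply, op_id]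
      rw [CategoryTheory.Functor.map_id]
      exact Category.id_comp x)
    (fun f g x => by
      simp only [AddMonoidHom.mk'_apply, op_comp, Functor.map_comp]
      exact Category.assoc _ _ _)

end ModuleScheme

variable {R}

/-- An `𝓡`-module is an `𝓡`-module scheme if it is isomorphic to the functor of points of
an `R`-module scheme. -/
def IsModuleScheme (F : ModuleFunctor R) : Prop :=
  ∃ X : ModuleScheme R, Nonempty (F ≅ X.functorOfPoints)

/-- An `𝓡`-module is a module scheme associated with an `R`-module if it is isomorphic to `𝓝^*`
for some `R`-module `N`. -/
def IsAssociatedModuleScheme (F : ModuleFunctor R) : Prop :=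
  ∃ N : ModuleCat.{u} R, Nonempty (F ≅ dualFunctor R N)

/-- `F` is a direct limit, in the category of `𝓡`-modules, of a direct system of `𝓡`-modules
with the property `P`, indexed by a (nonempty) upward directed set. -/
def IsDirectLimitOf (P : ModuleFunctor R → Prop) (F : ModuleFunctor R) : Prop :=
  ∃ (I : Type u) (_ : Preorder I) (_ : IsDirectedOrder I) (_ : Nonempty I)
    (D : I ⥤ ModuleFunctor R) (c : Cocone D),
    (∀ i, P (D.obj i)) ∧ Nonempty (IsColimit c) ∧ Nonempty (c.pt ≅ F)

end

end FunctorialModules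

end

/-! For a flat `M`, Lazard's theorem holds at the level of functors. The finite free modules over
`M` form a filtered category (`FreeOver`), by the equational criterion for flatness. The same
criterion shows that `A ⊗ M` is the colimit of the modules `A ⊗ Rⁿ` for every `A`. The
quasi-coherent module of `Rⁿ` is its own dual, so 𝓜 is a direct limit of module schemes associated
with free modules. Each 𝓝^* is the functor of points of `Spec (Sym N)`, which gives (2) ⇒ (3).

The converse (3) ⇒ (1) rests on square-zero extensions. If `S → S'` is an injective linear map, then
`Spec (R ⊕ S') → Spec (R ⊕ S)` is an epimorphism of schemes (`TrivSqZeroExt.epi_spec_map`). Hence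
`X(R ⊕ S) → X(R ⊕ S')` is injective for every scheme `X`, and injectivity survives direct limits. If
𝓜 is a direct limit of module schemes, `(R ⊕ S) ⊗ M → (R ⊕ S') ⊗ M` is therefore injective; its
restriction to `S ⊗ M → S' ⊗ M` is the injectivity that defines flatness. -/

noncomputable section

/-! ### Epimorphisms between spectra of trivial square-zero extensions -/

section

/-- An injective ring map all of whose stalk maps are injective, and which is surjective on spectra,
induces an epimorphism of schemes. -/
theorem AlgebraicGeometry.Spec.epi_map_of_injective_localRingHom {A B : CommRingCat.{u}} (φ : A ⟶ B)
    (hs : Function.Surjective (PrimeSpectrum.comap φ.hom))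
    (hφ : ∀ p : PrimeSpectrum B, Function.Injective
      (Localization.localRingHom (p.comap φ.hom).asIdeal p.asIdeal φ.hom rfl)) :
    Epi (Spec.map φ) := by
  -- Both forgetful functors are faithful, so they reflect epimorphisms, and the criterion for
  -- sheafed spaces applies.
  apply CategoryTheory.Functor.epi_of_epi_map (Scheme.forgetToLocallyRingedSpace)
  apply CategoryTheory.Functor.epi_of_epi_map (LocallyRingedSpace.forgetToSheafedSpace)
  apply SheafedSpace.epi_of_base_surjective_of_stalk_mono _ hs
  intro x
  refine ((MorphismProperty.monomorphisms CommRingCat).arrow_mk_iso_iff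
    (Scheme.arrowStalkMapSpecIso φ x)).mpr ?_
  exact ConcreteCategory.mono_of_injective _ (hφ x)

variable {R : Type u} [CommRing R] {S S' : Type u} [AddCommGroup S] [Module R S] [Module Rᵐᵒᵖ S]
  [IsCentralScalar R S] [AddCommGroup S'] [Module R S'] [Module Rᵐᵒᵖ S'] [IsCentralScalar R S']

theorem TrivSqZeroExt.map_injective {f : S →ₗ[R] S'} (hf : Function.Injective f) :
    Function.Injective (TrivSqZeroExt.map f) := by
  intro x y h
  ext
  · simpa using congrArg TrivSqZeroExt.fst h
  · exact hf (by simpa using congrArg TrivSqZeroExt.snd h)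

/-- The square-zero part is nilpotent, so it lies in every prime. -/
theorem TrivSqZeroExt.mem_prime_iff (p : Ideal (TrivSqZeroExt R S)) [p.IsPrime]
    (x : TrivSqZeroExt R S) : x ∈ p ↔ TrivSqZeroExt.inl x.fst ∈ p := by
  have h : TrivSqZeroExt.inr x.snd ∈ p :=
    Ideal.IsPrime.mem_of_pow_mem ‹_› 2 (by simp [pow_two])
  conv_lhs => rw [← TrivSqZeroExt.inl_fst_add_inr_snd_eq x]
  exact p.add_mem_iff_left h

/-- An element `b = b₀ + b₁` outside `p` that kills the image of `a` need not come from the smaller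
extension. Its multiple `(b₀ - b₁) b = b₀²` does, since it lies in `R`; it still kills that image
and is still outside `p`. -/
theorem TrivSqZeroExt.localRingHom_map_injective {f : S →ₗ[R] S'} (hf : Function.Injective f)
    (q : Ideal (TrivSqZeroExt R S)) [q.IsPrime] (p : Ideal (TrivSqZeroExt R S')) [p.IsPrime]
    (hq : q = p.comap (TrivSqZeroExt.map f).toRingHom) :
    Function.Injective (Localization.localRingHom q p (TrivSqZeroExt.map f).toRingHom hq) := by
  rw [injective_iff_map_eq_zero]
  intro z hz
  obtain ⟨a, s, rfl⟩ := IsLocalization.exists_mk'_eq q.primeCompl z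
  rw [Localization.localRingHom_mk', IsLocalization.mk'_eq_zero_iff] at hz
  obtain ⟨⟨b, hb⟩, h⟩ := hz
  rw [IsLocalization.mk'_eq_zero_iff]
  have hb' : TrivSqZeroExt.inl b.fst ∉ p := fun h' =>
    hb ((TrivSqZeroExt.mem_prime_iff p b).2 h')
  refine ⟨⟨TrivSqZeroExt.inl (b.fst * b.fst), ?_⟩, ?_⟩
  · intro h'
    have h'' : (TrivSqZeroExt.inl (b.fst * b.fst) : TrivSqZeroExt R S') ∈ p := by
      rw [← TrivSqZeroExt.map_inl f]
      rw [hq] at h'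
      exact h'
    rw [TrivSqZeroExt.inl_mul] at h''
    rcases Ideal.IsPrime.mem_or_mem ‹_› h'' with h | h <;> exact hb' h
  · apply TrivSqZeroExt.map_injective hf
    have h2 : (TrivSqZeroExt.inl (b.fst * b.fst) : TrivSqZeroExt R S') =
        (TrivSqZeroExt.inl b.fst - TrivSqZeroExt.inr b.snd) * b := by
      conv_rhs => enter [2]; rw [← TrivSqZeroExt.inl_fst_add_inr_snd_eq b]
      rw [mul_add, sub_mul, sub_mul, TrivSqZeroExt.inr_mul_inr, TrivSqZeroExt.inl_mul]
      ring
    rw [map_mul, map_zero, TrivSqZeroExt.map_inl, h2, mul_assoc]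
    exact (congrArg _ h).trans (mul_zero _)

theorem TrivSqZeroExt.epi_spec_map {f : S →ₗ[R] S'} (hf : Function.Injective f) :
    Epi (Spec.map (CommRingCat.ofHom (TrivSqZeroExt.map f).toRingHom)) := by
  apply Spec.epi_map_of_injective_localRingHom
  · intro q
    -- The preimage of `q` is its contraction along `R ⊕ S' → R → R ⊕ S`: a prime depends only on
    -- its trace on `R`.
    refine ⟨PrimeSpectrum.comap ((TrivSqZeroExt.inlHom R S).comp
      (TrivSqZeroExt.fstHom R R S').toRingHom) q, ?_⟩
    ext x
    rw [TrivSqZeroExt.mem_prime_iff q.asIdeal x]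
    simp
  · exact fun p => TrivSqZeroExt.localRingHom_map_injective hf _ p.asIdeal rfl

end

namespace FunctorialModules

/-! ### Injectivity along a morphism of algebras -/

variable {R : Type u} [CommRing R]

/-- The map `F(A) → F(B)` is injective. -/
def InjectiveAlong {A B : CommAlgCat.{u} R} (f : A ⟶ B) (F : ModuleFunctor R) : Prop :=
  Function.Injective (F.map f.op.op)

theorem InjectiveAlong.of_iso {A B : CommAlgCat.{u} R} {f : A ⟶ B} {F G : ModuleFunctor R}
    (e : F ≅ G) (h : InjectiveAlong f F) : InjectiveAlong f G := by
  have hinv (X) : Function.LeftInverse (e.hom.app X) (e.inv.app X) := fun x => by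
    have := congrArg (fun k => k.app X) e.inv_hom_id
    exact congrArg (fun k => k x) this
  intro x y hxy
  apply (hinv _).injective
  apply h
  rw [← PresheafOfModules.naturality_apply, ← PresheafOfModules.naturality_apply]
  exact congrArg _ hxy

/-- Evaluation at an algebra preserves colimits, and a directed colimit of injective maps is
injective: an equality over `B` already holds at some stage `k`, where it descends to `A`. -/
theorem InjectiveAlong.of_isDirectLimitOf {A B : CommAlgCat.{u} R} {f : A ⟶ B}
    {P : ModuleFunctor R → Prop} (hP : ∀ F, P F → InjectiveAlong f F) {F : ModuleFunctor R}
    (hF : IsDirectLimitOf P F) : InjectiveAlong f F := by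
  obtain ⟨I, _, _, _, D, c, hD, ⟨hc⟩, ⟨e⟩⟩ := hF
  refine InjectiveAlong.of_iso e ?_
  have hcol (X) := isColimitOfPreserves (PresheafOfModules.evaluation (ringFunctor R) X) hc
  intro x y hxy
  obtain ⟨i, x, rfl⟩ := Concrete.isColimit_exists_rep _ (hcol _) x
  obtain ⟨j, y, rfl⟩ := Concrete.isColimit_exists_rep _ (hcol _) y
  have hxy' : (c.ι.app i).app (op (op B)) ((D.obj i).map f.op.op x) =
      (c.ι.app j).app (op (op B)) ((D.obj j).map f.op.op y) := by
    exact (PresheafOfModules.naturality_apply (c.ι.app i) f.op.op x).trans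
      (hxy.trans (PresheafOfModules.naturality_apply (c.ι.app j) f.op.op y).symm)
  obtain ⟨k, g, h, hgh⟩ := Concrete.isColimit_exists_of_rep_eq _ (hcol _) _ _ hxy'
  have hgh' : (D.map g).app _ x = (D.map h).app _ y := by
    apply hP _ (hD k)
    exact (PresheafOfModules.naturality_apply (D.map g) f.op.op x).symm.trans
      (hgh.trans (PresheafOfModules.naturality_apply (D.map h) f.op.op y))
  exact Concrete.isColimit_rep_eq_of_exists _ _ _ ⟨k, g, h, hgh'⟩

/-- The transition map of a functor of points is precomposition with `Spec f`, so injectivity is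
cancellation of an epimorphism. -/
theorem InjectiveAlong.of_isModuleScheme {A B : CommAlgCat.{u} R} {f : A ⟶ B}
    (hf : Epi (Spec.map (CommRingCat.ofHom f.hom.toRingHom))) {F : ModuleFunctor R}
    (hF : IsModuleScheme F) : InjectiveAlong f F := by
  obtain ⟨X, ⟨e⟩⟩ := hF
  refine InjectiveAlong.of_iso e.symm fun x y hxy => ?_
  have : Epi ((algSpec (CommRingCat.of R)).map f.op) :=
    (Over.forget _).epi_of_epi_map hf
  exact (cancel_epi ((algSpec (CommRingCat.of R)).map f.op)).1 hxy

theorem flat_of_isDirectLimitOf_isModuleScheme {M : Type u} [AddCommGroup M] [Module R M]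
    (h : IsDirectLimitOf IsModuleScheme (quasiCoherent R M)) : Module.Flat R M := by
  rw [Module.Flat.iff_rTensor_preserves_injective_linearMap'.{u, u, u}]
  intro S S' _ _ _ _ f hf
  -- Square-zero extensions are formed from bimodules; the right action is taken equal to the left
  -- one.
  let : Module Rᵐᵒᵖ S := Module.compHom _ ((RingHom.id R).fromOpposite mul_comm)
  let : Module Rᵐᵒᵖ S' := Module.compHom _ ((RingHom.id R).fromOpposite mul_comm)
  have : IsCentralScalar R S := ⟨fun _ _ => rfl⟩
  have : IsCentralScalar R S' := ⟨fun _ _ => rfl⟩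
  have hinj : InjectiveAlong (CommAlgCat.ofHom (TrivSqZeroExt.map f)) (quasiCoherent R M) :=
    InjectiveAlong.of_isDirectLimitOf
      (fun F => InjectiveAlong.of_isModuleScheme (TrivSqZeroExt.epi_spec_map hf)) h
  have hinj' : Function.Injective ((TrivSqZeroExt.map f).toLinearMap.rTensor M) := hinj
  -- `S` is a direct summand of `R ⊕ S`, so this needs no flatness.
  have hinr : Function.Injective ((TrivSqZeroExt.inrHom R S).rTensor M) := by
    apply Function.LeftInverse.injective (g := (TrivSqZeroExt.sndHom R S).rTensor M)
    intro t
    have h : TrivSqZeroExt.sndHom R S ∘ₗ TrivSqZeroExt.inrHom R S = LinearMap.id := by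
      ext; simp
    rw [← LinearMap.comp_apply, ← LinearMap.rTensor_comp, h, LinearMap.rTensor_id]
    rfl
  have hcomp : (TrivSqZeroExt.inrHom R S').rTensor M ∘ₗ f.rTensor M =
      (TrivSqZeroExt.map f).toLinearMap.rTensor M ∘ₗ (TrivSqZeroExt.inrHom R S).rTensor M := by
    rw [← LinearMap.rTensor_comp, ← LinearMap.rTensor_comp, TrivSqZeroExt.map_comp_inrHom]
  have := hinj'.comp hinr
  rw [← LinearMap.coe_comp, ← hcomp, LinearMap.coe_comp] at this
  exact this.of_comp

/-- A morphism of `𝓡`-modules from a family of maps that are linear and compatible with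
transition maps. -/
def ModuleFunctor.homMk {F G : ModuleFunctor R}
    (app : ∀ A : CommAlgCat.{u} R, F.obj (op (op A)) →ₗ[(ringFunctor R).obj (op (op A))]
      G.obj (op (op A)))
    (naturality : ∀ {A B : CommAlgCat.{u} R} (f : A ⟶ B) (x : F.obj (op (op A))),
      app B (F.map f.op.op x) = G.map f.op.op (app A x)) : F ⟶ G where
  app X := ModuleCat.ofHom (app X.unop.unop)
  naturality f := by
    ext x
    exact naturality f.unop.unop x

/-- An isomorphism of `𝓡`-modules from a family of linear equivalences compatible with
transition maps. -/
def ModuleFunctor.isoMk {F G : ModuleFunctor R}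
    (app : ∀ A : CommAlgCat.{u} R, F.obj (op (op A)) ≃ₗ[(ringFunctor R).obj (op (op A))]
      G.obj (op (op A)))
    (naturality : ∀ {A B : CommAlgCat.{u} R} (f : A ⟶ B) (x : F.obj (op (op A))),
      app B (F.map f.op.op x) = G.map f.op.op (app A x)) : F ≅ G :=
  PresheafOfModules.isoMk (fun X => (app X.unop.unop).toModuleIso) fun X Y f => by
    ext x
    exact naturality f.unop.unop x

/-! ### Functoriality of quasi-coherent modules -/

/-- The morphism of quasi-coherent `𝓡`-modules induced by an `R`-linear map. -/
def quasiCoherentMap {M N : Type u} [AddCommGroup M] [Module R M] [AddCommGroup N] [Module R N]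
    (g : M →ₗ[R] N) : quasiCoherent R M ⟶ quasiCoherent R N :=
  ModuleFunctor.homMk (F := quasiCoherent R M) (G := quasiCoherent R N)
    (fun A => (g.baseChange A : A ⊗[R] M →ₗ[A] A ⊗[R] N)) fun {A B} f x => by
      have h : g.lTensor B ∘ₗ f.hom.toLinearMap.rTensor M =
          f.hom.toLinearMap.rTensor N ∘ₗ g.lTensor A := by
        rw [LinearMap.lTensor_comp_rTensor, LinearMap.rTensor_comp_lTensor]
      exact LinearMap.congr_fun h x

variable (R) in
/-- The functor `M ↦ 𝓜` from `R`-modules to quasi-coherent `𝓡`-modules. -/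
def quasiCoherentFunctor : ModuleCat.{u} R ⥤ ModuleFunctor R where
  obj M := quasiCoherent R M
  map g := quasiCoherentMap g.hom
  map_id M := by
    ext X x
    exact LinearMap.congr_fun (LinearMap.lTensor_id _ _) x
  map_comp f g := by
    ext X x
    exact LinearMap.congr_fun (LinearMap.lTensor_comp X.unop.unop g.hom f.hom) x

/-- The quasi-coherent module of a finite free module is isomorphic to its dual. -/
def quasiCoherentIsoDual (ι : Type) [Finite ι] :
    quasiCoherent R (ι →₀ R) ≅ dualFunctor R (ι →₀ R) :=
  let _ := Classical.decEq ι
  let b (A : CommAlgCat.{u} R) : Module.Basis ι A (A ⊗[R] (ι →₀ R)) :=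
    Finsupp.basisSingleOne.baseChange A
  ModuleFunctor.isoMk (F := quasiCoherent R (ι →₀ R)) (G := dualFunctor R (ι →₀ R))
    (fun A => (b A).toDualEquiv) fun {A B} f x => by
      suffices h : ∀ x : A ⊗[R] (ι →₀ R), (b B).toDual (f.hom.toLinearMap.rTensor _ x) =
          dualMap f ((b A).toDual x) from h x
      intro x
      refine (b B).ext fun j => ?_
      -- The bases are base changes of one basis over `R`, so both sides at `b B j` reduce to the
      -- `j`-th coordinate.
      have hb : b B j = f.hom.toLinearMap.rTensor _ (b A j) := by simp [b]
      rw [Module.Basis.toDual_apply_left, hb, dualMap_rTensor, Module.Basis.toDual_apply_left]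
      induction x with
      | zero => simp
      | tmul a v => simp [b]
      | add x y hx hy => simp only [map_add, Finsupp.add_apply, hx, hy]

/-! ### Flat modules as filtered colimits of finite free modules -/

variable (R) in
/-- The category of finite free modules over `M`, with objects the linear maps `Rⁿ → M`. -/
structure FreeOver (M : Type u) [AddCommGroup M] [Module R M] : Type u where
  /-- the rank -/
  rank : ℕ
  /-- the structure map -/
  hom : (Fin rank →₀ R) →ₗ[R] M

namespace FreeOver

variable {M : Type u} [AddCommGroup M] [Module R M]

instance : SmallCategory (FreeOver R M) where
  Hom X Y := {a : (Fin X.rank →₀ R) →ₗ[R] (Fin Y.rank →₀ R) // Y.hom ∘ₗ a = X.hom}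
  id X := ⟨LinearMap.id, rfl⟩
  comp f g := ⟨g.1 ∘ₗ f.1, by rw [← LinearMap.comp_assoc, g.2, f.2]⟩

/-- A map from a finite free module to a flat `M` factors through another finite free module, and
the factorization can be chosen to kill a given relation. Applied to `X.hom.coprod Y.hom` this gives
upper bounds; applied to `f - g` it coequalizes parallel arrows. -/
instance [Module.Flat R M] : IsFiltered (FreeOver R M) where
  nonempty := ⟨⟨0, 0⟩⟩
  cocone_objs X Y := by
    obtain ⟨k, a, y, h⟩ := Module.Flat.exists_factorization_of_finitePresentation
      (X.hom.coprod Y.hom)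
    refine ⟨⟨k, y⟩, ⟨a ∘ₗ .inl R _ _, ?_⟩, ⟨a ∘ₗ .inr R _ _, ?_⟩, trivial⟩
    · rw [← LinearMap.comp_assoc, ← h, LinearMap.coprod_inl]
    · rw [← LinearMap.comp_assoc, ← h, LinearMap.coprod_inr]
  cocone_maps X Y f g := by
    obtain ⟨k, a, y, h, h'⟩ := Module.Flat.exists_factorization_of_comp_eq_zero_of_free
      (f := f.1 - g.1) (x := Y.hom) (by rw [LinearMap.comp_sub, f.2, g.2, sub_self])
    refine ⟨⟨k, y⟩, ⟨a, h.symm⟩, Subtype.ext ?_⟩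
    exact sub_eq_zero.1 ((LinearMap.comp_sub _ _ _).symm.trans h')

variable (R M) in
/-- The functor sending `Rⁿ → M` to `Rⁿ`. -/
def forget : FreeOver R M ⥤ ModuleCat.{u} R where
  obj X := ModuleCat.of R (Fin X.rank →₀ R)
  map f := ModuleCat.ofHom f.1

variable (R M) in
/-- The quasi-coherent `𝓡`-modules of the finite free modules over `M`. -/
def quasiCoherentDiagram : FreeOver R M ⥤ ModuleFunctor R :=
  forget R M ⋙ quasiCoherentFunctor R

variable (R M) in
/-- The cocone with point `𝓜` on the quasi-coherent modules of finite free modules over `M`. -/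
def quasiCoherentCocone : Cocone (quasiCoherentDiagram R M) :=
  (quasiCoherentFunctor R).mapCocone (c := ⟨ModuleCat.of R M,
    { app X := ModuleCat.ofHom X.hom
      naturality X Y f := by
        ext1
        exact f.2 }⟩)

theorem exists_lTensor_hom_eq (A : Type u) [AddCommGroup A] [Module R A] (t : A ⊗[R] M) :
    ∃ (X : FreeOver R M) (s : A ⊗[R] (Fin X.rank →₀ R)), X.hom.lTensor A s = t := by
  obtain ⟨n, a, m, rfl⟩ := TensorProduct.exists_sum_tmul_eq t
  exact ⟨⟨n, Finsupp.linearCombination R m⟩, ∑ i, a i ⊗ₜ Finsupp.single i 1, by simp⟩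

theorem exists_sum_tmul_single_eq {R A ι : Type*} [CommRing R] [AddCommGroup A] [Module R A]
    [Fintype ι] (t : A ⊗[R] (ι →₀ R)) : ∃ a : ι → A, ∑ i, a i ⊗ₜ[R] Finsupp.single i 1 = t := by
  induction t with
  | zero => exact ⟨0, by simp⟩
  | tmul a v =>
    refine ⟨fun i => v i • a, ?_⟩
    simp_rw [TensorProduct.smul_tmul, ← TensorProduct.tmul_sum]
    simp [Finsupp.univ_sum_single]
  | add x y hx hy =>
    obtain ⟨a, rfl⟩ := hx
    obtain ⟨b, rfl⟩ := hy
    exact ⟨a + b, by simp [TensorProduct.add_tmul, Finset.sum_add_distrib]⟩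

/-- By flatness, a vanishing sum `∑ sᵢ ⊗ mᵢ` vanishes trivially: `mᵢ = ∑ⱼ aᵢⱼ yⱼ` with `∑ᵢ aᵢⱼ sᵢ =
0`. The matrix `a` is the required arrow, and the `yⱼ` define its target. -/
theorem exists_lTensor_eq_zero [Module.Flat R M] (A : Type u) [AddCommGroup A] [Module R A]
    (X : FreeOver R M) (s : A ⊗[R] (Fin X.rank →₀ R)) (hs : X.hom.lTensor A s = 0) :
    ∃ (Y : FreeOver R M) (f : X ⟶ Y), f.1.lTensor A s = 0 := by
  obtain ⟨s, rfl⟩ := exists_sum_tmul_single_eq s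
  have h : ∑ i, s i ⊗ₜ[R] X.hom (Finsupp.single i 1) = 0 := by
    rw [← hs]
    simp
  obtain ⟨k, a, y, h₁, h₂⟩ :=
    TensorProduct.vanishesTrivially_of_sum_tmul_eq_zero_of_rTensor_injective R
      (Module.Flat.rTensor_preserves_injective_linearMap _ Subtype.val_injective) h
  refine ⟨⟨k, Finsupp.linearCombination R y⟩,
    ⟨Finsupp.linearCombination R fun i => ∑ j, Finsupp.single j (a i j), ?_⟩, ?_⟩
  · ext i
    simp [h₁]
  · have h₃ (i : Fin X.rank) (j : Fin k) : s i ⊗ₜ[R] Finsupp.single j (a i j) =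
        (a i j • s i) ⊗ₜ[R] Finsupp.single j 1 := by
      rw [TensorProduct.smul_tmul, Finsupp.smul_single, smul_eq_mul, mul_one]
    simp only [map_sum, LinearMap.lTensor_tmul, Finsupp.linearCombination_single, one_smul,
      TensorProduct.tmul_sum, h₃]
    rw [Finset.sum_comm]
    simp [← TensorProduct.sum_tmul, h₂]

theorem exists_lTensor_eq [Module.Flat R M] (A : Type u) [AddCommGroup A] [Module R A]
    (X : FreeOver R M) (s s' : A ⊗[R] (Fin X.rank →₀ R))
    (h : X.hom.lTensor A s = X.hom.lTensor A s') :
    ∃ (Y : FreeOver R M) (f : X ⟶ Y), f.1.lTensor A s = f.1.lTensor A s' := by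
  obtain ⟨Y, f, hf⟩ := exists_lTensor_eq_zero A X (s - s') (by rw [map_sub, sub_eq_zero, h])
  exact ⟨Y, f, by rwa [map_sub, sub_eq_zero] at hf⟩

/-- `𝓜` is the colimit of the quasi-coherent modules of the finite free modules over `M`. -/
def isColimitQuasiCoherentCocone [Module.Flat R M] : IsColimit (quasiCoherentCocone R M) := by
  -- Colimits may be checked on each algebra and, being filtered, on underlying sets: every tensor
  -- comes from some stage, and tensors identified in the limit agree at a later stage.
  refine PresheafOfModules.evaluationJointlyReflectsColimits _ _ fun X => ?_
  refine isColimitOfReflects (CategoryTheory.forget (ModuleCat ((ringFunctor R).obj X))) ?_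
  refine Types.FilteredColimit.isColimitOf' _ _ ?_ ?_
  · intro t
    obtain ⟨Y, s, h⟩ := exists_lTensor_hom_eq X.unop.unop t
    exact ⟨Y, s, h.symm⟩
  · intro Y s s' h
    exact exists_lTensor_eq X.unop.unop Y s s' h

end FreeOver

theorem isDirectLimitOf_of_flat (M : Type u) [AddCommGroup M] [Module R M] [Module.Flat R M] :
    IsDirectLimitOf IsAssociatedModuleScheme (quasiCoherent R M) := by
  -- `FreeOver R M` is filtered but not a poset; a final functor from a directed set leaves the
  -- colimit unchanged.
  obtain ⟨I, _, _, _, F, _⟩ := IsFiltered.exists_directed (FreeOver R M)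
  refine ⟨I, inferInstance, ‹_›, ‹_›, F ⋙ FreeOver.quasiCoherentDiagram R M,
    (FreeOver.quasiCoherentCocone R M).whisker F, fun i => ?_,
    ⟨(Functor.Final.isColimitWhiskerEquiv F _).symm FreeOver.isColimitQuasiCoherentCocone⟩,
    ⟨Iso.refl _⟩⟩
  exact ⟨ModuleCat.of R _, ⟨quasiCoherentIsoDual (Fin (F.obj i).rank)⟩⟩

/-! ### Functions on `R`-schemes -/

/-- This and the next two lemmas make the adjunction between global sections and `Spec` explicit,
including its compatibility with a base. They feed `homAlgSpecEquiv`. -/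
theorem toSpecΓ_comp_map_appTop {X : Scheme.{u}} {B : CommRingCat.{u}} (g : X ⟶ Spec B) :
    X.toSpecΓ ≫ Spec.map ((Scheme.ΓSpecIso B).inv ≫ g.appTop) = g := by
  rw [Spec.map_comp, ← Scheme.toSpecΓ_naturality_assoc, toSpecΓ_SpecMap_ΓSpecIso_inv,
    Category.comp_id]

theorem toSpecΓ_comp_map_comp_map {X : Scheme.{u}} {A B : CommRingCat.{u}} {t : X ⟶ Spec A}
    {α : A ⟶ B} {φ : B ⟶ Γ(X, ⊤)} (h : α ≫ φ = (Scheme.ΓSpecIso A).inv ≫ t.appTop) :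
    (X.toSpecΓ ≫ Spec.map φ) ≫ Spec.map α = t := by
  rw [Category.assoc, ← Spec.map_comp, h, toSpecΓ_comp_map_appTop]

theorem ΓSpecIso_inv_comp_appTop {X : Scheme.{u}} {B : CommRingCat.{u}} (φ : B ⟶ Γ(X, ⊤)) :
    (Scheme.ΓSpecIso B).inv ≫ (X.toSpecΓ ≫ Spec.map φ).appTop = φ := by
  rw [Scheme.Hom.comp_appTop, ← Scheme.ΓSpecIso_inv_naturality_assoc, Scheme.toSpecΓ_appTop,
    Iso.inv_hom_id, Category.comp_id]

/-- The `R`-algebra of global functions on an `R`-scheme. -/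
def globalSections (T : Over (Spec (CommRingCat.of R))) : CommAlgCat.{u} R :=
  letI : Algebra R Γ(T.left, ⊤) :=
    ((Scheme.ΓSpecIso (CommRingCat.of R)).inv ≫ T.hom.appTop).hom.toAlgebra
  CommAlgCat.of R Γ(T.left, ⊤)

/-- The pullback of global functions along a morphism of `R`-schemes. -/
def globalSectionsMap {S T : Over (Spec (CommRingCat.of R))} (g : S ⟶ T) :
    globalSections T →ₐ[R] globalSections S where
  __ := g.left.appTop.hom
  commutes' r := by
    have h := congrArg Scheme.Hom.appTop (Over.w g)
    rw [Scheme.Hom.comp_appTop] at h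
    exact congrArg (fun k => k ((Scheme.ΓSpecIso (CommRingCat.of R)).inv r)) h

theorem globalSectionsMap_id (T : Over (Spec (CommRingCat.of R))) :
    globalSectionsMap (𝟙 T) = AlgHom.id R (globalSections T) := by
  ext a
  change (𝟙 T.left : T.left ⟶ T.left).appTop a = a
  rw [Scheme.Hom.id_appTop]
  rfl

theorem globalSectionsMap_comp {S T U : Over (Spec (CommRingCat.of R))} (g : S ⟶ T) (h : T ⟶ U) :
    globalSectionsMap (g ≫ h) = (globalSectionsMap g).comp (globalSectionsMap h) := by
  ext a
  change (g ≫ h).left.appTop a = g.left.appTop (h.left.appTop a)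
  rw [Over.comp_left, Scheme.Hom.comp_appTop]
  rfl

/-- The `R`-algebra of functions on `Spec A` is `A`. -/
def globalSectionsSpec (A : CommAlgCat.{u} R) :
    A ≃ₐ[R] globalSections ((algSpec (CommRingCat.of R)).obj (op A)) where
  __ := (Scheme.ΓSpecIso (CommRingCat.of A)).symm.commRingCatIsoToRingEquiv
  commutes' r := ConcreteCategory.congr_hom
    (Scheme.ΓSpecIso_inv_naturality (CommRingCat.ofHom (algebraMap R A))) r

theorem globalSectionsMap_algSpec_map {A B : CommAlgCat.{u} R} (f : A ⟶ B) (a : A) :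
    globalSectionsMap ((algSpec (CommRingCat.of R)).map f.op) (globalSectionsSpec A a) =
      globalSectionsSpec B (f.hom a) :=
  ModuleScheme.toFunction_naturality f a

/-- The morphisms from an `R`-scheme `T` to `Spec B` are the algebra maps from `B` to the global
functions on `T`. -/
def homAlgSpecEquiv (T : Over (Spec (CommRingCat.of R))) (B : CommAlgCat.{u} R) :
    (T ⟶ (algSpec (CommRingCat.of R)).obj (op B)) ≃ (B →ₐ[R] globalSections T) where
  toFun g := (globalSectionsMap g).comp (globalSectionsSpec B).toAlgHom
  invFun φ := Over.homMk (T.left.toSpecΓ ≫ Spec.map (CommRingCat.ofHom φ.toRingHom)) <| by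
    refine toSpecΓ_comp_map_comp_map (X := T.left) (A := CommRingCat.of R)
      (B := CommRingCat.of B) (α := CommRingCat.ofHom (algebraMap R B)) ?_
    ext r
    exact φ.commutes r
  left_inv g := Over.OverMorphism.ext (toSpecΓ_comp_map_appTop g.left)
  right_inv φ := by
    ext b
    exact ConcreteCategory.congr_hom
      (ΓSpecIso_inv_comp_appTop (CommRingCat.ofHom φ.toRingHom)) b

theorem homAlgSpecEquiv_comp {S T : Over (Spec (CommRingCat.of R))} (f : S ⟶ T)
    {B : CommAlgCat.{u} R} (g : T ⟶ (algSpec (CommRingCat.of R)).obj (op B)) :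
    homAlgSpecEquiv S B (f ≫ g) = (globalSectionsMap f).comp (homAlgSpecEquiv T B g) := by
  change (globalSectionsMap (f ≫ g)).comp _ = _
  rw [globalSectionsMap_comp]
  rfl

/-! ### The spectrum of a symmetric algebra -/

section

variable (R) (N : Type u) [AddCommGroup N] [Module R N]

/-- The functor of linear maps from `N` to the global functions. -/
def linearFunctions : (Over (Spec (CommRingCat.of R)))ᵒᵖ ⥤ AddGrpCat.{u} where
  obj T := AddGrpCat.of (N →ₗ[R] globalSections T.unop)
  map g := AddGrpCat.ofHom
    (AddMonoidHom.mk' (fun w => (globalSectionsMap g.unop).toLinearMap ∘ₗ w)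
      fun w w' => LinearMap.comp_add _ _ (globalSectionsMap g.unop).toLinearMap)
  map_id T := by
    refine AddGrpCat.hom_ext (AddMonoidHom.ext fun w => ?_)
    change (globalSectionsMap (𝟙 T.unop)).toLinearMap ∘ₗ w = w
    rw [globalSectionsMap_id]
    rfl
  map_comp {S T U} f g := by
    refine AddGrpCat.hom_ext (AddMonoidHom.ext fun w => ?_)
    change (globalSectionsMap (g.unop ≫ f.unop)).toLinearMap ∘ₗ w = _
    rw [globalSectionsMap_comp]
    rfl

/-- The spectrum of the symmetric algebra. -/
abbrev specSym : Over (Spec (CommRingCat.of R)) :=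
  (algSpec (CommRingCat.of R)).obj (op (CommAlgCat.of R (SymmetricAlgebra R N)))

variable {R N} in
/-- The points of the spectrum of the symmetric algebra of `N` are the linear maps from `N` to
the global functions. -/
def specSymHomEquiv (T : Over (Spec (CommRingCat.of R))) :
    (T ⟶ specSym R N) ≃ (N →ₗ[R] globalSections T) :=
  (homAlgSpecEquiv T (CommAlgCat.of R (SymmetricAlgebra R N))).trans SymmetricAlgebra.lift.symm

variable {R N} in
theorem specSymHomEquiv_comp {S T : Over (Spec (CommRingCat.of R))} (f : S ⟶ T)
    (g : T ⟶ specSym R N) : specSymHomEquiv S (f ≫ g) =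
      (globalSectionsMap f).toLinearMap ∘ₗ specSymHomEquiv T g :=
  congrArg SymmetricAlgebra.lift.symm (homAlgSpecEquiv_comp f g)

/-- The spectrum of the symmetric algebra of `N` represents the functor of linear maps
from `N` to the global functions. -/
def specSymRepresentableBy :
    (linearFunctions R N ⋙ CategoryTheory.forget _).RepresentableBy (specSym R N) where
  homEquiv := specSymHomEquiv _
  homEquiv_comp f g := specSymHomEquiv_comp f g

/-- The group law comes from the Yoneda lemma, by transport of the addition of linear maps. -/
instance : AddGrpObj (specSym R N) :=
  AddGrpObj.ofRepresentableBy _ (linearFunctions R N) (specSymRepresentableBy R N)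

variable {R N} in
theorem specSymHomEquiv_add {T : Over (Spec (CommRingCat.of R))} (x y : T ⟶ specSym R N) :
    specSymHomEquiv T (x + y) = specSymHomEquiv T x + specSymHomEquiv T y := by
  -- The universal sum is the point attached to the sum of the two projections; `x + y` is its
  -- pullback along `(x, y)`.
  have h : x + y = lift x y ≫ (specSymHomEquiv _).symm
    (specSymHomEquiv _ (fst _ _) + specSymHomEquiv _ (snd _ _)) := rfl
  rw [h, specSymHomEquiv_comp, Equiv.apply_symm_apply, LinearMap.comp_add, ← specSymHomEquiv_comp,
    ← specSymHomEquiv_comp, lift_fst, lift_snd]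

instance : IsCommAddMonObj (specSym R N) where
  add_comm := by
    have h : AddMonObj.add = (specSymHomEquiv _).symm (specSymHomEquiv _
      (fst (specSym R N) (specSym R N)) + specSymHomEquiv _ (snd _ _)) := rfl
    apply (specSymHomEquiv _).injective
    rw [h, specSymHomEquiv_comp, Equiv.apply_symm_apply, LinearMap.comp_add,
      ← specSymHomEquiv_comp, ← specSymHomEquiv_comp, braiding_hom_fst, braiding_hom_snd, add_comm]

/-- The first projection `𝔸¹ × Spec (Sym N) ⟶ 𝔸¹` as a global function. -/
def scalarFunction : globalSections (affineLine R ⊗ specSym R N) :=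
  ((toAffineLine_bijective _).2 (fst (affineLine R) (specSym R N))).choose

theorem toAffineLine_scalarFunction :
    toAffineLine (scalarFunction R N) = fst (affineLine R) (specSym R N) :=
  ((toAffineLine_bijective _).2 (fst (affineLine R) (specSym R N))).choose_spec

/-- The multiplication by scalars on the spectrum of a symmetric algebra. -/
def specSymAct : affineLine R ⊗ specSym R N ⟶ specSym R N :=
  (specSymHomEquiv _).symm
    (scalarFunction R N • specSymHomEquiv _ (snd (affineLine R) (specSym R N)))

variable {R N} in
-- This reduces each module scheme axiom for `specSymAct` to an axiom of the module of linear maps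
-- on `N`.
theorem specSymHomEquiv_act {T : Over (Spec (CommRingCat.of R))} (a : Γ(T.left, ⊤))
    (x : T ⟶ specSym R N) : specSymHomEquiv T (lift (toAffineLine a) x ≫ specSymAct R N) =
      letI a' : globalSections T := a
      a' • specSymHomEquiv T x := by
  rw [specSymHomEquiv_comp, specSymAct, Equiv.apply_symm_apply]
  -- The coordinate function pulls back to `a` along `(a, x)`, because functions are determined by
  -- their morphisms to 𝔸¹.
  have hc : (lift (toAffineLine a) x).left.appTop (scalarFunction R N) = a := by
    apply (toAffineLine_bijective T).1
    refine (comp_toAffineLine _ _).symm.trans ?_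
    rw [toAffineLine_scalarFunction, lift_fst]
  have hx : specSymHomEquiv T x =
      (globalSectionsMap (CartesianMonoidalCategory.lift (toAffineLine a) x)).toLinearMap ∘ₗ
        specSymHomEquiv _ (snd (affineLine R) (specSym R N)) := by
    rw [← specSymHomEquiv_comp, lift_snd]
  rw [hx]
  ext n
  exact (map_mul (globalSectionsMap (lift (toAffineLine a) x)) (scalarFunction R N) _).trans
    (congrArg (· * _) hc)

/-- The spectrum of the symmetric algebra of an `R`-module, as an `R`-module scheme. -/
def symModuleScheme : ModuleScheme R where
  X := specSym R N
  act := specSymAct R N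
  act_add {T} a x y := by
    apply (specSymHomEquiv _).injective
    rw [specSymHomEquiv_add, specSymHomEquiv_act, specSymHomEquiv_act, specSymHomEquiv_act,
      specSymHomEquiv_add]
    exact smul_add (A := N →ₗ[R] globalSections T) _ _ _
  add_act {T} a b x := by
    apply (specSymHomEquiv _).injective
    rw [specSymHomEquiv_add, specSymHomEquiv_act, specSymHomEquiv_act, specSymHomEquiv_act]
    exact add_smul (R := globalSections T) (M := N →ₗ[R] globalSections T) _ _ _
  mul_act {T} a b x := by
    apply (specSymHomEquiv _).injective
    rw [specSymHomEquiv_act, specSymHomEquiv_act, specSymHomEquiv_act]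
    exact mul_smul (α := globalSections T) (β := N →ₗ[R] globalSections T) _ _ _
  one_act x := by
    apply (specSymHomEquiv _).injective
    rw [specSymHomEquiv_act]
    exact one_smul (globalSections _) _

/-- The `A`-points of the spectrum of the symmetric algebra of `N` are the linear maps `N → A`. -/
def symPointsEquiv (A : CommAlgCat.{u} R) :
    (symModuleScheme R N).Points A ≃ₗ[A] (N →ₗ[R] A) where
  __ := (specSymHomEquiv ((algSpec (CommRingCat.of R)).obj (op A))).trans
    ((globalSectionsSpec A).symm.toLinearEquiv.congrRight (M := N)).toEquiv
  map_add' x y := by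
    ext n
    exact (congrArg (fun w => (globalSectionsSpec A).symm (w n)) (specSymHomEquiv_add x y)).trans
      (map_add _ _ _)
  map_smul' a x := by
    ext n
    refine (congrArg (fun w => (globalSectionsSpec A).symm (w n)) (specSymHomEquiv_act _ x)).trans
      ((map_mul (globalSectionsSpec A).symm _ _).trans (congrArg (· * _) ?_))
    exact (globalSectionsSpec A).symm_apply_apply a

theorem symPointsEquiv_apply (A : CommAlgCat.{u} R) (x : (symModuleScheme R N).Points A) (n : N) :
    globalSectionsSpec A (symPointsEquiv R N A x n) = specSymHomEquiv _ x n :=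
  (globalSectionsSpec A).apply_symm_apply _

/-- The functor of points of the spectrum of the symmetric algebra of `N` is `𝓝^*`. -/
def symFunctorOfPointsIso : (symModuleScheme R N).functorOfPoints ≅ dualFunctor R N :=
  ModuleFunctor.isoMk (F := (symModuleScheme R N).functorOfPoints) (G := dualFunctor R N)
    (fun A => ((symPointsEquiv R N A).trans (LinearMap.liftBaseChangeEquiv A) :
      (symModuleScheme R N).Points A ≃ₗ[A] Module.Dual A (A ⊗[R] N))) fun {A B} f x => by
    suffices h : ∀ x : (symModuleScheme R N).Points A,
        LinearMap.liftBaseChangeEquiv B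
            (symPointsEquiv R N B ((algSpec (CommRingCat.of R)).map f.op ≫ x)) =
          dualMap f (LinearMap.liftBaseChangeEquiv A (symPointsEquiv R N A x)) from h x
    intro x
    ext n
    -- Among functions on `Spec B`, naturality is the compatibility of `specSymHomEquiv` with
    -- pullback.
    apply (globalSectionsSpec B).injective
    suffices h : globalSectionsSpec B
        (symPointsEquiv R N B ((algSpec (CommRingCat.of R)).map f.op ≫ x) n) =
          globalSectionsSpec B (f.hom (symPointsEquiv R N A x n)) by
      simpa [dualMap] using h
    rw [symPointsEquiv_apply, ← globalSectionsMap_algSpec_map, symPointsEquiv_apply]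
    exact LinearMap.congr_fun (specSymHomEquiv_comp _ x) n

end

/-! ### Assembly of the equivalences -/

theorem IsAssociatedModuleScheme.isModuleScheme {F : ModuleFunctor R}
    (h : IsAssociatedModuleScheme F) : IsModuleScheme F := by
  obtain ⟨N, ⟨e⟩⟩ := h
  exact ⟨symModuleScheme R N, ⟨e ≪≫ (symFunctorOfPointsIso R N).symm⟩⟩

theorem IsDirectLimitOf.mono {P Q : ModuleFunctor R → Prop} (hPQ : ∀ F, P F → Q F)
    {F : ModuleFunctor R} (h : IsDirectLimitOf P F) : IsDirectLimitOf Q F := by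
  obtain ⟨I, _, _, _, D, c, hD, hc, e⟩ := h
  exact ⟨I, inferInstance, ‹_›, ‹_›, D, c, fun i => hPQ _ (hD i), hc, e⟩

end FunctorialModules

end

theorem mainTheorem1 (R : Type u) [CommRing R] (M : Type u) [AddCommGroup M] [Module R M] :
    [Module.Flat R M,
      FunctorialModules.IsDirectLimitOf FunctorialModules.IsAssociatedModuleScheme
        (FunctorialModules.quasiCoherent R M),
      FunctorialModules.IsDirectLimitOf FunctorialModules.IsModuleScheme
        (FunctorialModules.quasiCoherent R M)].TFAE := by
  tfae_have 1 → 2 := fun _ => FunctorialModules.isDirectLimitOf_of_flat M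
  tfae_have 2 → 3 := fun h => h.mono fun _ =>
    FunctorialModules.IsAssociatedModuleScheme.isModuleScheme
  tfae_have 3 → 1 := FunctorialModules.flat_of_isDirectLimitOf_isModuleScheme
  tfae_finish
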